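/- Let $m\ge 0$ and $p\ge 1$ be integers, and let $\Omega=\prod_{i=1}^m(a_i,b_i)\subset\mathbb R^m$, $a_i<b_i$, be an open box. Let $T\subset\Omega$ be an embedded $C^{p+1}$ hypersurface of $\mathbb R^m$ without boundary (not necessarily closed, connected or orientable), and let $S\subset\Omega$ be an embedded $C^{p+1}$ hypersurface, possibly with boundary, whose closure $\overline S$ in $\mathbb R^m$ is contained in $T$. Let $f\in C^p(T)$, i.e. near every point of $T$ the function $f$ is the restriction to $T$ of a $C^p$ function on an open subset of $\mathbb R^m$. Then there is a function $\tilde f\in C^p(\mathbb R^m)$ which is periodic with period $b_i-a_i$ in the $i$-th coordinate for each $i$ (so that $\tilde f|_\Omega\in C^p(\Omega)$ is periodic together with its derivatives up to order $p$), and which is a first-order Closest Point-like extension of $f$ from $S$: $$\tilde f|_S=f|_S\qquad\text{and}\qquad n_S\cdot\nabla\tilde f\,|_S=0,$$ where $n_S(x)$ denotes a unit vector orthogonal to the tangent space of $S$ at $x$ (the condition does not depend on its sign). Moreover, $\tilde f$ can be chosen such that * there is an open set $V$ with $\overline S\subset V\subset\Omega$ such that every $x\in V$ has a unique closest point $\mathrm{cp}_T(x)=\operatorname{argmin}_{y\in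 T}\|x-y\|_2$ in $T$, and $\tilde f=f\circ \mathrm{cp}_T$ on $V$; * $\tilde f|_\Omega$ vanishes outside some compact subset of $\Omega$. -/

import Mathlib

/-- The open box `∏ᵢ (aᵢ, bᵢ)` in `ℝᵐ`. -/
def openBox {m : ℕ} (a b : Fin m → ℝ) : Set (EuclideanSpace ℝ (Fin m)) :=
  {x | ∀ i, a i < x i ∧ x i < b i}

/-- `F : ℝᵐ → ℝ` is periodic with respect to the box `∏ᵢ (aᵢ, bᵢ)`: for every `i` the side length
`bᵢ - aᵢ` is a period in the `i`-th coordinate direction. -/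
def IsBoxPeriodic {m : ℕ} (a b : Fin m → ℝ) (F : EuclideanSpace ℝ (Fin m) → ℝ) : Prop :=
  ∀ i x, F (x + EuclideanSpace.single i (b i - a i)) = F x

/-- `T` is an embedded `Cᵏ` hypersurface (without boundary) of `ℝᵐ`: near each of its points it is
the zero set of a `Cᵏ` function with nonvanishing differential at that point. It need not be closed,
bounded, connected or orientable. -/
def IsHypersurface {m : ℕ} (k : ℕ) (T : Set (EuclideanSpace ℝ (Fin m))) : Prop :=
  ∀ x ∈ T, ∃ U : Set (EuclideanSpace ℝ (Fin m)), IsOpen U ∧ x ∈ U ∧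
    ∃ g : EuclideanSpace ℝ (Fin m) → ℝ, ContDiffOn ℝ k g U ∧ fderiv ℝ g x ≠ 0 ∧
      T ∩ U = {y ∈ U | g y = 0}

/-- `S` is an embedded `Cᵏ` hypersurface of `ℝᵐ` with (possibly empty) boundary: near each of its
points it is either as in `IsHypersurface` (interior points), or it is given by `g = 0`, `h ≥ 0`
with `Cᵏ` functions `g`, `h` whose differentials are linearly independent at the point, where `h`
vanishes (boundary points). -/
def IsHypersurfaceWithBoundary {m : ℕ} (k : ℕ) (S : Set (EuclideanSpace ℝ (Fin m))) : Prop :=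
  ∀ x ∈ S, ∃ U : Set (EuclideanSpace ℝ (Fin m)), IsOpen U ∧ x ∈ U ∧
    ∃ g : EuclideanSpace ℝ (Fin m) → ℝ, ContDiffOn ℝ k g U ∧
      ((fderiv ℝ g x ≠ 0 ∧ S ∩ U = {y ∈ U | g y = 0}) ∨
        ∃ h : EuclideanSpace ℝ (Fin m) → ℝ, ContDiffOn ℝ k h U ∧ h x = 0 ∧
          LinearIndependent ℝ ![fderiv ℝ g x, fderiv ℝ h x] ∧
          S ∩ U = {y ∈ U | g y = 0 ∧ 0 ≤ h y})

/-- `f ∈ Cᵏ(T)` for a subset (an embedded submanifold) `T` of `ℝᵐ`: near each point of `T`, `f`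
agrees on `T` with a `Cᵏ` function on an open subset of `ℝᵐ`. Only the values of `f` on `T`
matter. -/
def IsContDiffOnSurface {m : ℕ} (k : ℕ) (f : EuclideanSpace ℝ (Fin m) → ℝ)
    (T : Set (EuclideanSpace ℝ (Fin m))) : Prop :=
  ∀ x ∈ T, ∃ U : Set (EuclideanSpace ℝ (Fin m)), IsOpen U ∧ x ∈ U ∧
    ∃ F : EuclideanSpace ℝ (Fin m) → ℝ, ContDiffOn ℝ k F U ∧ ∀ y ∈ T ∩ U, F y = f y

/-- `ν` is a unit normal vector to `S` at `x`: a unit vector orthogonal to all tangent vectors to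
`S` at `x`. -/
def IsUnitNormal {m : ℕ} (S : Set (EuclideanSpace ℝ (Fin m))) (x ν : EuclideanSpace ℝ (Fin m)) :
    Prop :=
  ‖ν‖ = 1 ∧ ∀ v ∈ tangentConeAt ℝ S x, inner ℝ ν v = 0

/-- `F ∈ C¹(Ω)` is a first-order Closest Point-like extension of `f` from `S`: on `S` we have
`n_S · ∇F = 0` and `F = f`. (The condition does not depend on the sign of the normal.) -/
def IsFirstOrderCPLikeExtension {m : ℕ} (Ω S : Set (EuclideanSpace ℝ (Fin m)))
    (f F : EuclideanSpace ℝ (Fin m) → ℝ) : Prop :=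
  ContDiffOn ℝ 1 F Ω ∧
    (∀ x ∈ S, ∀ ν, IsUnitNormal S x ν → inner ℝ ν (gradient F x) = 0) ∧
    ∀ x ∈ S, F x = f x

/-- `y` is a Euclidean closest point of `T` to `x`. -/
def IsClosestPoint {m : ℕ} (T : Set (EuclideanSpace ℝ (Fin m)))
    (x y : EuclideanSpace ℝ (Fin m)) : Prop :=
  y ∈ T ∧ ∀ z ∈ T, ‖x - y‖ ≤ ‖x - z‖

/-!
The extension is `f ∘ cp`, where `cp` is the closest point map of `T`, cut off near `closure S` and
continued periodically.

Near `x₀ ∈ T` let `T` be the zero set of `g`. Instead of parametrizing `T`, consider the map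
`Ψ (y, t) = (y + t • ∇g y, g y)` of `ℝᵐ × ℝ`. It is `Cᵖ` and its differential at `(x₀, 0)` is
invertible because `∇g x₀ ≠ 0`, so it has a local `Cᵖ` inverse. If `y` is a closest point of `T` to
a point `x` near `x₀`, then `y` is near `x₀`, and Lagrange multipliers give `x = y + t • ∇g y`, that
is, `Ψ (y, t) = (x, 0)` with `t` small. Hence `y` is the first component of `Ψ⁻¹ (x, 0)`: closest
points are unique and depend on `x` in a `Cᵖ` way. They exist because `T` is locally compact. This
is `exists_contDiffAt_closestPoint`. Since `Ψ (x₀, t) = (x₀ + t • ∇g x₀, 0)`, the map `cp` takes the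
value `x₀` on a short normal segment through `x₀`, so the derivative of `f ∘ cp` at `x₀` in the
direction `∇g x₀` vanishes (`IsHypersurface.closestPoint_extension_at`).

A vector orthogonal to the tangent cone of `S` at `x` lies on a fixed line: by the implicit function
theorem the tangent cone contains the kernel of the differential of a defining function of `S`, or at
a boundary point an open half of it, which spans the kernel
(`IsHypersurfaceWithBoundary.exists_normal_direction`). The normals of `T` at `x` are orthogonal to
that cone too, so the unit normals of `S` are multiples of them.

Finally, `closure S` is compact, so a smooth cutoff turns `f ∘ cp` into a `Cᵖ` function supported in
a compact subset of the box, and composing it with the reduction `boxMod` modulo the period lattice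
keeps it `Cᵖ` (`ContDiff.comp_boxMod`).
-/

open Set Filter Topology

variable {m : ℕ}

/-! ### Tangent cones and normals of hypersurfaces -/

theorem exists_curve_in_level_set {E : Type*} [NormedAddCommGroup E] [NormedSpace ℝ E]
    [CompleteSpace E] {g : E → ℝ} {g' : E →L[ℝ] ℝ} {x v : E}
    (hg : HasStrictFDerivAt g g' x) (hg' : g' ≠ 0) (hv : g' v = 0) :
    ∃ γ : ℝ → E, HasDerivAt γ v 0 ∧ γ 0 = x ∧ ∀ᶠ t in 𝓝 0, g (γ t) = g x := by
  have hr : g'.range = ⊤ := by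
    apply LinearMap.range_eq_top.2
    apply LinearMap.surjective
    intro h
    apply hg'
    ext z
    exact LinearMap.congr_fun h z
  have hvk : v ∈ g'.ker := hv
  let w : g'.ker := ⟨v, hvk⟩
  let L : ℝ → g'.ker := fun t => t • w
  have hL : HasDerivAt L w 0 := by
    simpa using (hasDerivAt_id (0 : ℝ)).smul_const w
  have hL0 : L 0 = 0 := zero_smul _ _
  refine ⟨fun t => hg.implicitFunction g g' hr (g x) (L t), ?_, ?_, ?_⟩
  · have h1 := (hg.to_implicitFunction hr).hasFDerivAt
    rw [← hL0] at h1
    exact h1.comp_hasDerivAt 0 hL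
  · simp [hL0]
  · have h2 : Tendsto (fun t : ℝ => (g x, L t)) (𝓝 0) (𝓝 (g x, 0)) := by
      have := hL.continuousAt.tendsto
      rw [hL0] at this
      exact tendsto_const_nhds.prodMk_nhds this
    exact h2.eventually (hg.map_implicitFunction_eq hr)

theorem mem_tangentConeAt_of_hasDerivAt {E : Type*} [NormedAddCommGroup E] [NormedSpace ℝ E]
    {S : Set E} {γ : ℝ → E} {x v : E} (hγ : HasDerivAt γ v 0) (h0 : γ 0 = x)
    (hS : ∀ᶠ t in 𝓝[>] 0, γ t ∈ S) : v ∈ tangentConeAt ℝ S x := by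
  refine mem_tangentConeAt_of_seq (𝓝[>] (0 : ℝ)) (fun t => t⁻¹) (fun t => γ t - x) ?_ ?_ ?_
  · have : Tendsto (fun t => γ t - x) (𝓝 0) (𝓝 (γ 0 - x)) :=
      hγ.continuousAt.tendsto.sub_const x
    rw [h0, sub_self] at this
    exact this.mono_left nhdsWithin_le_nhds
  · simpa using hS
  · have := hγ.tendsto_slope_zero_right
    simpa [h0] using this

/-- At a boundary point of `{g = 0, h ≥ 0}`, the tangent vectors of `{g = 0}` pointing strictly into
`{h > 0}` belong to the tangent cone. -/
theorem mem_tangentConeAt_of_boundary_chart {E : Type*} [NormedAddCommGroup E] [NormedSpace ℝ E]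
    [CompleteSpace E] {S U : Set E} {g h : E → ℝ} {g' h' : E →L[ℝ] ℝ} {x v : E}
    (hU : U ∈ 𝓝 x) (hg : HasStrictFDerivAt g g' x) (hg' : g' ≠ 0) (hgx : g x = 0)
    (hh : HasFDerivAt h h' x) (hhx : h x = 0)
    (hS : ∀ y ∈ U, g y = 0 → 0 ≤ h y → y ∈ S) (hv : g' v = 0) (hhv : 0 < h' v) :
    v ∈ tangentConeAt ℝ S x := by
  obtain ⟨γ, hγ, h0, hγg⟩ := exists_curve_in_level_set hg hg' hv
  refine mem_tangentConeAt_of_hasDerivAt hγ h0 ?_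
  have hc : Tendsto γ (𝓝 0) (𝓝 x) := h0 ▸ hγ.continuousAt.tendsto
  have hd : HasDerivAt (h ∘ γ) (h' v) 0 := by
    rw [← h0] at hh
    exact hh.comp_hasDerivAt 0 hγ
  have hpos : ∀ᶠ t in 𝓝[>] (0 : ℝ), 0 < h (γ t) := by
    have h1 := hd.tendsto_slope_zero_right.eventually (lt_mem_nhds hhv)
    filter_upwards [h1, self_mem_nhdsWithin] with t ht htp
    simp only [zero_add, Function.comp_apply, h0, hhx, sub_zero, smul_eq_mul] at ht
    exact (mul_pos_iff_of_pos_left (inv_pos.2 htp)).1 ht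
  filter_upwards [hpos, nhdsWithin_le_nhds (hc.eventually hU), nhdsWithin_le_nhds hγg]
    with t h1 h2 h3
  exact hS _ h2 (h3.trans hgx) h1.le

/-- The vectors orthogonal to the tangent cone of `S` at one of its points all lie on one line. At a
boundary point the tangent cone is only known to contain the vectors `v` of the kernel of `dg` with
`dh v > 0`, but these span the kernel. -/
theorem IsHypersurfaceWithBoundary.exists_normal_direction {k : ℕ} (hk : 1 ≤ k)
    {S : Set (EuclideanSpace ℝ (Fin m))} (hS : IsHypersurfaceWithBoundary k S)
    {x : EuclideanSpace ℝ (Fin m)} (hx : x ∈ S) :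
    ∃ e : EuclideanSpace ℝ (Fin m), ∀ u : EuclideanSpace ℝ (Fin m),
      (∀ v ∈ tangentConeAt ℝ S x, inner ℝ u v = 0) → ∃ α : ℝ, u = α • e := by
  have hk0 : (k : WithTop ℕ∞) ≠ 0 := by exact_mod_cast (by omega : k ≠ 0)
  obtain ⟨U, hU, hxU, g, hg, hcase⟩ := hS x hx
  have hUx := hU.mem_nhds hxU
  have hgs := (hg.contDiffAt hUx).hasStrictFDerivAt hk0
  refine ⟨gradient g x, fun u hu => ?_⟩
  suffices hker : ∀ v, fderiv ℝ g x v = 0 → inner ℝ u v = 0 by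
    have := FiniteDimensional.mem_span_of_iInf_ker_le_ker (𝕜 := ℝ)
      (L := fun _ : Unit => (fderiv ℝ g x).toLinearMap) (K := (innerSL ℝ u).toLinearMap)
      (by
        intro v hv
        simp only [Submodule.mem_iInf, LinearMap.mem_ker] at hv
        exact hker v (hv ()))
    rw [range_const, Submodule.mem_span_singleton] at this
    obtain ⟨α, hα⟩ := this
    refine ⟨α, ext_inner_right ℝ fun v => ?_⟩
    have := LinearMap.congr_fun hα v
    rw [inner_smul_left, gradient, InnerProductSpace.toDual_symm_apply]
    simpa using this.symm
  rcases hcase with ⟨hg', hSU⟩ | ⟨h, hh, hhx, hli, hSU⟩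
  · intro v hv
    have hgx : g x = 0 := (hSU ▸ (⟨hx, hxU⟩ : x ∈ S ∩ U) : x ∈ {y ∈ U | g y = 0}).2
    obtain ⟨γ, hγ, h0, hγg⟩ := exists_curve_in_level_set hgs hg' hv
    refine hu v (mem_tangentConeAt_of_hasDerivAt hγ h0 (nhdsWithin_le_nhds ?_))
    have hc : Tendsto γ (𝓝 0) (𝓝 x) := h0 ▸ hγ.continuousAt.tendsto
    filter_upwards [hc.eventually hUx, hγg] with t h1 h2
    exact (hSU.symm ▸ (⟨h1, h2.trans hgx⟩ : γ t ∈ {y ∈ U | g y = 0}) : γ t ∈ S ∩ U).1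
  · have hgx : g x = 0 := (hSU ▸ (⟨hx, hxU⟩ : x ∈ S ∩ U) : x ∈ {y ∈ U | g y = 0 ∧ 0 ≤ h y}).2.1
    have hg' : fderiv ℝ g x ≠ 0 := hli.ne_zero 0
    have hhd := ((hh.contDiffAt hUx).differentiableAt hk0).hasFDerivAt
    have hpos : ∀ v, fderiv ℝ g x v = 0 → 0 < fderiv ℝ h x v → inner ℝ u v = 0 :=
      fun v hv hv' => hu v <| mem_tangentConeAt_of_boundary_chart hUx hgs hg' hgx hhd hhx
        (fun y h1 h2 h3 =>
          (hSU.symm ▸ (⟨h1, h2, h3⟩ : y ∈ {y ∈ U | g y = 0 ∧ 0 ≤ h y}) : y ∈ S ∩ U).1) hv hv'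
    obtain ⟨w, hw, hw'⟩ : ∃ w, fderiv ℝ g x w = 0 ∧ 0 < fderiv ℝ h x w := by
      by_contra! hcon
      have hz : ∀ w, fderiv ℝ g x w = 0 → fderiv ℝ h x w = 0 := fun w hw =>
        le_antisymm (hcon w hw) (by simpa using hcon (-w) (by simp [hw]))
      have := FiniteDimensional.mem_span_of_iInf_ker_le_ker (𝕜 := ℝ)
        (L := fun _ : Unit => (fderiv ℝ g x).toLinearMap) (K := (fderiv ℝ h x).toLinearMap)
        (by
          intro v hv
          simp only [Submodule.mem_iInf, LinearMap.mem_ker] at hv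
          exact hz v (hv ()))
      rw [range_const, Submodule.mem_span_singleton] at this
      obtain ⟨α, hα⟩ := this
      refine (LinearIndependent.pair_iff' hg').1 hli α ?_
      ext v
      exact LinearMap.congr_fun hα v
    intro v hv
    have h1 := hpos w hw hw'
    -- `v + s • w` points into the half space `h' > 0` for `s` large
    have h2 := hpos (v + ((1 - fderiv ℝ h x v) / fderiv ℝ h x w) • w) (by simp [hv, hw])
      (by
        simp only [map_add, map_smul, smul_eq_mul]
        rw [div_mul_cancel₀ _ hw'.ne']
        linarith)
    simpa [inner_add_right, inner_smul_right, h1] using h2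

theorem inner_gradient_eq_zero_of_mem_tangentConeAt {S : Set (EuclideanSpace ℝ (Fin m))}
    {g : EuclideanSpace ℝ (Fin m) → ℝ} {x v : EuclideanSpace ℝ (Fin m)}
    (hg : DifferentiableAt ℝ g x) (hgS : ∀ᶠ y in 𝓝[S] x, g y = 0) (hgx : g x = 0)
    (hv : v ∈ tangentConeAt ℝ S x) : inner ℝ (gradient g x) v = 0 := by
  have h0 : HasFDerivWithinAt g (0 : EuclideanSpace ℝ (Fin m) →L[ℝ] ℝ) S x :=
    (hasFDerivWithinAt_const (0 : ℝ) x S).congr_of_eventuallyEq hgS hgx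
  rw [gradient, InnerProductSpace.toDual_symm_apply]
  exact hg.hasFDerivAt.hasFDerivWithinAt.unique_on h0 hv

/-! ### The closest point map near a hypersurface -/

/-- First-order condition for a closest point: `x - y` is normal to `T` at `y`. -/
theorem IsClosestPoint.exists_eq_add_smul_gradient {T U : Set (EuclideanSpace ℝ (Fin m))}
    {g : EuclideanSpace ℝ (Fin m) → ℝ} {x y : EuclideanSpace ℝ (Fin m)}
    (hxy : IsClosestPoint T x y) (hU : U ∈ 𝓝 y) (hTU : T ∩ U = {z ∈ U | g z = 0})
    (hg : HasStrictFDerivAt g (fderiv ℝ g y) y) (hg0 : gradient g y ≠ 0) :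
    ∃ t : ℝ, x = y + t • gradient g y := by
  have hgy : g y = 0 :=
    (hTU ▸ (⟨hxy.1, mem_of_mem_nhds hU⟩ : y ∈ T ∩ U) : y ∈ {z ∈ U | g z = 0}).2
  have hφ := (hasStrictFDerivAt_norm_sq (x - y)).comp y ((hasStrictFDerivAt_id y).const_sub x)
  have hmin : IsLocalExtrOn (fun z => ‖x - z‖ ^ 2) {z | g z = g y} y := by
    refine Or.inl ?_
    filter_upwards [self_mem_nhdsWithin, nhdsWithin_le_nhds hU] with z hz hzU
    have hzT : z ∈ T :=
      (hTU.symm ▸ (⟨hzU, Eq.trans hz hgy⟩ : z ∈ {z ∈ U | g z = 0}) : z ∈ T ∩ U).1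
    have := hxy.2 z hzT
    gcongr
  -- the multiplier `b` of the squared distance cannot vanish because `∇g y ≠ 0`
  obtain ⟨a, b, hab, h⟩ := hmin.exists_multipliers_of_hasStrictFDerivAt_1d hg hφ
  have hin : ∀ v, a * inner ℝ (gradient g y) v = 2 * b * inner ℝ (x - y) v := by
    intro v
    have h1 : a * fderiv ℝ g y v + -(b * (2 * (inner ℝ x v - inner ℝ y v))) = 0 := by
      simpa using DFunLike.congr_fun h v
    rw [gradient, InnerProductSpace.toDual_symm_apply]
    rw [inner_sub_left]
    linarith
  have hvec : a • gradient g y = (2 * b) • (x - y) :=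
    ext_inner_right ℝ fun v => by simpa only [inner_smul_left, RCLike.conj_to_real] using hin v
  have hb : b ≠ 0 := by
    rintro rfl
    have ha : a ≠ 0 := fun ha => hab (by simp [ha])
    rw [mul_zero, zero_smul] at hvec
    exact (smul_ne_zero ha hg0) hvec
  refine ⟨(2 * b)⁻¹ * a, ?_⟩
  rw [mul_smul, hvec, inv_smul_smul₀ (by simpa using hb)]
  abel

theorem IsClosestPoint.norm_sub_le {T : Set (EuclideanSpace ℝ (Fin m))}
    {x y x₀ : EuclideanSpace ℝ (Fin m)} (hxy : IsClosestPoint T x y) (hx₀ : x₀ ∈ T) :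
    ‖y - x₀‖ ≤ 2 * ‖x - x₀‖ := by
  have h1 := hxy.2 x₀ hx₀
  have h2 : ‖y - x₀‖ ≤ ‖x - y‖ + ‖x - x₀‖ := by
    rw [norm_sub_rev x y]
    simpa using norm_add_le (y - x) (x - x₀)
  linarith

/-- Although `T` need not be closed, closest points exist near each `x₀ ∈ T`: a small closed ball
around `x₀` cuts out a compact piece of `T`, and points of `T` outside this ball are further away from
`x` than `x₀`. -/
theorem eventually_exists_isClosestPoint {T U : Set (EuclideanSpace ℝ (Fin m))}
    {g : EuclideanSpace ℝ (Fin m) → ℝ} {x₀ : EuclideanSpace ℝ (Fin m)} (hx₀ : x₀ ∈ T)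
    (hU : U ∈ 𝓝 x₀) (hg : ContinuousOn g U) (hTU : T ∩ U = {z ∈ U | g z = 0}) :
    ∀ᶠ x in 𝓝 x₀, ∃ y, IsClosestPoint T x y := by
  obtain ⟨r, hr, hrU⟩ := Metric.nhds_basis_closedBall.mem_iff.1 hU
  have hC : IsCompact (T ∩ Metric.closedBall x₀ r) := by
    have : T ∩ Metric.closedBall x₀ r = Metric.closedBall x₀ r ∩ g ⁻¹' {0} := by
      rw [← inter_eq_right.2 hrU, ← inter_assoc, hTU]
      ext z
      simp only [mem_inter_iff, mem_ofPred_eq, mem_preimage, mem_singleton_iff]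
      tauto
    rw [this]
    exact (isCompact_closedBall x₀ r).of_isClosed_subset
      ((hg.mono hrU).preimage_isClosed_of_isClosed Metric.isClosed_closedBall isClosed_singleton)
      inter_subset_left
  have hx₀C : x₀ ∈ T ∩ Metric.closedBall x₀ r := ⟨hx₀, Metric.mem_closedBall_self hr.le⟩
  filter_upwards [Metric.ball_mem_nhds x₀ (half_pos hr)] with x hx
  rw [mem_ball_iff_norm] at hx
  obtain ⟨y, hy, hmin⟩ := hC.exists_isMinOn ⟨x₀, hx₀C⟩
    (f := fun z => ‖x - z‖) (by fun_prop)
  refine ⟨y, hy.1, fun z hz => ?_⟩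
  by_cases hzr : z ∈ Metric.closedBall x₀ r
  · exact hmin ⟨hz, hzr⟩
  · have h1 : ‖x - y‖ ≤ ‖x - x₀‖ := hmin hx₀C
    rw [mem_closedBall_iff_norm, not_le] at hzr
    have h2 : ‖z - x₀‖ ≤ ‖x - z‖ + ‖x - x₀‖ := by
      rw [norm_sub_rev x z]
      simpa using norm_add_le (z - x) (x - x₀)
    linarith

/-- The map `(y, t) ↦ (y + t • ∇g y, g y)` has an invertible differential at `(x₀, 0)`, namely
`(v, s) ↦ (v + s • ∇g x₀, dg v)`. -/
theorem hasFDerivAt_normal_map {g : EuclideanSpace ℝ (Fin m) → ℝ} {x₀ : EuclideanSpace ℝ (Fin m)}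
    (hg : DifferentiableAt ℝ g x₀) (hn : DifferentiableAt ℝ (gradient g) x₀)
    (hg0 : gradient g x₀ ≠ 0) :
    ∃ A : (EuclideanSpace ℝ (Fin m) × ℝ) ≃L[ℝ] (EuclideanSpace ℝ (Fin m) × ℝ),
      HasFDerivAt (fun q : EuclideanSpace ℝ (Fin m) × ℝ => (q.1 + q.2 • gradient g q.1, g q.1))
        (A : (EuclideanSpace ℝ (Fin m) × ℝ) →L[ℝ] (EuclideanSpace ℝ (Fin m) × ℝ)) (x₀, 0) := by
  let fstL := ContinuousLinearMap.fst ℝ (EuclideanSpace ℝ (Fin m)) ℝ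
  let sndL := ContinuousLinearMap.snd ℝ (EuclideanSpace ℝ (Fin m)) ℝ
  let A := (fstL + sndL.smulRight (gradient g x₀)).prod ((fderiv ℝ g x₀).comp fstL)
  have hA : HasFDerivAt
      (fun q : EuclideanSpace ℝ (Fin m) × ℝ => (q.1 + q.2 • gradient g q.1, g q.1)) A (x₀, 0) := by
    have hf : HasFDerivAt (fun q : EuclideanSpace ℝ (Fin m) × ℝ => q.1) fstL (x₀, 0) :=
      hasFDerivAt_fst
    have hs : HasFDerivAt (fun q : EuclideanSpace ℝ (Fin m) × ℝ => q.2) sndL (x₀, 0) :=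
      hasFDerivAt_snd
    have hn' : HasFDerivAt (fun q : EuclideanSpace ℝ (Fin m) × ℝ => gradient g q.1) _ (x₀, 0) :=
      HasFDerivAt.comp (x₀, (0 : ℝ)) (g := gradient g) hn.hasFDerivAt hf
    have hg' : HasFDerivAt (fun q : EuclideanSpace ℝ (Fin m) × ℝ => g q.1) _ (x₀, 0) :=
      HasFDerivAt.comp (x₀, (0 : ℝ)) (g := g) hg.hasFDerivAt hf
    refine ((hf.add (hs.smul hn')).prodMk hg').congr_fderiv ?_
    simp [A]
  have hinj : Function.Injective A.toLinearMap := by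
    rw [← LinearMap.ker_eq_bot, LinearMap.ker_eq_bot']
    rintro ⟨v, s⟩ h
    have h1 : v + s • gradient g x₀ = 0 := congrArg Prod.fst h
    have h2 : fderiv ℝ g x₀ v = 0 := congrArg Prod.snd h
    have h3 : inner ℝ (gradient g x₀) v = 0 := by
      rw [gradient, InnerProductSpace.toDual_symm_apply, h2]
    -- pairing `v + s • n = 0` with `n` leaves `s * ‖n‖² = 0`
    have h4 : s = 0 := by
      have := congrArg (inner ℝ (gradient g x₀)) h1
      rw [inner_add_right, inner_smul_right, h3, inner_zero_right, zero_add] at this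
      exact (mul_eq_zero.1 this).resolve_right (by simpa using hg0)
    subst h4
    simpa using h1
  refine ⟨(LinearEquiv.ofInjectiveEndo A.toLinearMap hinj).toContinuousLinearEquiv, ?_⟩
  convert hA using 1
  ext v <;> rfl

/-- Near a point `x₀` of the hypersurface `T = {g = 0}`, closest points exist, are unique, and are
given by a `Cᵖ` map, which is constant on a short normal segment through `x₀`. -/
theorem exists_contDiffAt_closestPoint {p : ℕ} (hp : 1 ≤ p)
    {T U : Set (EuclideanSpace ℝ (Fin m))} {g : EuclideanSpace ℝ (Fin m) → ℝ}
    {x₀ : EuclideanSpace ℝ (Fin m)} (hx₀ : x₀ ∈ T) (hU : IsOpen U) (hx₀U : x₀ ∈ U)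
    (hg : ContDiffOn ℝ (p + 1 : ℕ) g U) (hg0 : gradient g x₀ ≠ 0)
    (hTU : T ∩ U = {z ∈ U | g z = 0}) :
    ∃ π : EuclideanSpace ℝ (Fin m) → EuclideanSpace ℝ (Fin m), ContDiffAt ℝ p π x₀ ∧
      (∀ᶠ x in 𝓝 x₀, IsClosestPoint T x (π x) ∧ ∀ z, IsClosestPoint T x z → z = π x) ∧
      ∀ᶠ t in 𝓝 (0 : ℝ), π (x₀ + t • gradient g x₀) = x₀ := by
  have hp0 : (p : WithTop ℕ∞) ≠ 0 := by exact_mod_cast (by omega : p ≠ 0)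
  have hp10 : ((p + 1 : ℕ) : WithTop ℕ∞) ≠ 0 := by exact_mod_cast p.succ_ne_zero
  have hUx := hU.mem_nhds hx₀U
  have hgx : g x₀ = 0 :=
    (hTU ▸ (⟨hx₀, hx₀U⟩ : x₀ ∈ T ∩ U) : x₀ ∈ {z ∈ U | g z = 0}).2
  have hgc := hg.contDiffAt hUx
  have hnc : ContDiffAt ℝ p (gradient g) x₀ :=
    (InnerProductSpace.toDual ℝ (EuclideanSpace ℝ (Fin m))).symm.toContinuousLinearEquiv.contDiff
      |>.contDiffAt.comp x₀ (hgc.fderiv_right (m := p) (by norm_cast))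
  obtain ⟨A, hA⟩ := hasFDerivAt_normal_map (hgc.differentiableAt hp10)
    (hnc.differentiableAt hp0) hg0
  set Ψ := fun q : EuclideanSpace ℝ (Fin m) × ℝ => (q.1 + q.2 • gradient g q.1, g q.1) with hΨ
  have hΨ0 : Ψ (x₀, 0) = (x₀, 0) := by simp [hΨ, hgx]
  have hΨc : ContDiffAt ℝ p Ψ (x₀, 0) := by
    have hf : ContDiffAt ℝ p (fun q : EuclideanSpace ℝ (Fin m) × ℝ => q.1) (x₀, 0) :=
      contDiffAt_fst
    have h1 : ContDiffAt ℝ p (fun q : EuclideanSpace ℝ (Fin m) × ℝ => gradient g q.1) (x₀, 0) :=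
      ContDiffAt.comp (x₀, (0 : ℝ)) (g := gradient g) hnc hf
    have h2 : ContDiffAt ℝ p (fun q : EuclideanSpace ℝ (Fin m) × ℝ => g q.1) (x₀, 0) :=
      ContDiffAt.comp (x₀, (0 : ℝ)) (g := g) (hgc.of_le (by exact_mod_cast p.le_succ)) hf
    exact (hf.add (contDiffAt_snd.smul h1)).prodMk h2
  let e := hΨc.localInverse hA hp0
  have he : ContDiffAt ℝ p e (x₀, 0) := hΨ0 ▸ hΨc.to_localInverse hA hp0
  have hleft : ∀ᶠ q in 𝓝 (x₀, (0 : ℝ)), e (Ψ q) = q :=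
    (hΨc.hasStrictFDerivAt' hA hp0).eventually_left_inverse
  -- every closest point is parametrized by `Ψ`, hence is the one read off from its inverse
  have huniq : ∀ᶠ x in 𝓝 x₀, ∀ y, IsClosestPoint T x y → y = (e (x, 0)).1 := by
    obtain ⟨δ₁, hδ₁, h₁⟩ := Metric.eventually_nhds_iff_ball.1 hleft
    have hc : 0 < ‖gradient g x₀‖ / 2 := half_pos (norm_pos_iff.2 hg0)
    set c := ‖gradient g x₀‖ / 2 with hcdef
    have hn : ∀ᶠ y in 𝓝 x₀, c < ‖gradient g y‖ :=
      hnc.continuousAt.norm.eventually (lt_mem_nhds (by rw [hcdef]; linarith))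
    obtain ⟨δ₂, hδ₂, h₂⟩ := Metric.eventually_nhds_iff_ball.1 (hn.and hUx)
    -- closest points to `x` are within `2 * ‖x - x₀‖` of `x₀`, and `|t| * c ≤ ‖x - x₀‖`
    have hr : 0 < min (min δ₁ δ₂ / 2) (δ₁ * c) := by positivity
    filter_upwards [Metric.ball_mem_nhds x₀ hr] with x hx y hxy
    rw [mem_ball_iff_norm, lt_min_iff, lt_div_iff₀ two_pos, mul_comm, lt_min_iff] at hx
    obtain ⟨⟨hx1, hx2⟩, hx3⟩ := hx
    have hyx := hxy.norm_sub_le hx₀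
    obtain ⟨hyc, hyU⟩ := h₂ y (mem_ball_iff_norm.2 (hyx.trans_lt hx2))
    have hyU' : U ∈ 𝓝 y := hU.mem_nhds hyU
    have hy0 : gradient g y ≠ 0 := norm_pos_iff.1 (hc.trans hyc)
    obtain ⟨t, ht⟩ := hxy.exists_eq_add_smul_gradient hyU' hTU
      ((hg.contDiffAt hyU').hasStrictFDerivAt hp10) hy0
    have hgy : g y = 0 := (hTU ▸ (⟨hxy.1, hyU⟩ : y ∈ T ∩ U) : y ∈ {z ∈ U | g z = 0}).2
    have htb : |t| < δ₁ := by
      have h1 : |t| * ‖gradient g y‖ ≤ ‖x - x₀‖ := by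
        have := hxy.2 x₀ hx₀
        rwa [show x - y = t • gradient g y by rw [sub_eq_iff_eq_add']; exact ht,
          norm_smul, Real.norm_eq_abs] at this
      by_contra! hcon
      have : δ₁ * c ≤ |t| * ‖gradient g y‖ := by gcongr
      linarith
    have hq : Ψ (y, t) = (x, 0) := by simp [hΨ, hgy, ← ht]
    have := h₁ (y, t) (by
      rw [← ball_prod_same]
      exact ⟨mem_ball_iff_norm.2 (hyx.trans_lt hx1), by simpa using htb⟩)
    rw [← hq, this]
  refine ⟨fun x => (e (x, 0)).1, ?_, ?_, ?_⟩
  · exact contDiffAt_fst.comp x₀ (he.comp x₀ (contDiffAt_id.prodMk contDiffAt_const))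
  · filter_upwards [huniq, eventually_exists_isClosestPoint hx₀ hUx hg.continuousOn hTU]
      with x hx ⟨y, hy⟩
    exact ⟨hx y hy ▸ hy, hx⟩
  · have h1 : Tendsto (fun t : ℝ => (x₀, t)) (𝓝 0) (𝓝 (x₀, 0)) :=
      tendsto_const_nhds.prodMk_nhds tendsto_id
    filter_upwards [h1.eventually hleft] with t ht
    have h2 : Ψ (x₀, t) = (x₀ + t • gradient g x₀, 0) := by simp [hΨ, hgx]
    change (e (x₀ + t • gradient g x₀, 0)).1 = x₀
    rw [← h2, ht]

/-- For any choice `cp` of closest points of `T`, the function `f ∘ cp` is `Cᵖ` at each `x₀ ∈ T` and its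
derivative there vanishes in some nonzero direction `n` normal to `T`. -/
theorem IsHypersurface.closestPoint_extension_at {p : ℕ} (hp : 1 ≤ p)
    {T : Set (EuclideanSpace ℝ (Fin m))} (hT : IsHypersurface (p + 1) T)
    {f : EuclideanSpace ℝ (Fin m) → ℝ} (hf : IsContDiffOnSurface p f T)
    {cp : EuclideanSpace ℝ (Fin m) → EuclideanSpace ℝ (Fin m)}
    (hcp : ∀ x, (∃ y, IsClosestPoint T x y) → IsClosestPoint T x (cp x))
    {x₀ : EuclideanSpace ℝ (Fin m)} (hx₀ : x₀ ∈ T) :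
    ContDiffAt ℝ p (f ∘ cp) x₀ ∧
      (∀ᶠ x in 𝓝 x₀, IsClosestPoint T x (cp x) ∧ ∀ z, IsClosestPoint T x z → z = cp x) ∧
      cp x₀ = x₀ ∧
      ∃ n : EuclideanSpace ℝ (Fin m), n ≠ 0 ∧ (∀ v ∈ tangentConeAt ℝ T x₀, inner ℝ n v = 0) ∧
        inner ℝ n (gradient (f ∘ cp) x₀) = 0 := by
  have hp0 : (p : WithTop ℕ∞) ≠ 0 := by exact_mod_cast (by omega : p ≠ 0)
  have hp10 : ((p + 1 : ℕ) : WithTop ℕ∞) ≠ 0 := by exact_mod_cast p.succ_ne_zero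
  obtain ⟨U, hU, hxU, g, hg, hg', hTU⟩ := hT x₀ hx₀
  have hg0 : gradient g x₀ ≠ 0 := by simpa [gradient] using hg'
  obtain ⟨π, hπ, hπT, hπn⟩ := exists_contDiffAt_closestPoint hp hx₀ hU hxU hg hg0 hTU
  have hπx : π x₀ = x₀ := by simpa using hπn.self_of_nhds
  have hcpπ : cp =ᶠ[𝓝 x₀] π := hπT.mono fun x hx => hx.2 _ (hcp x ⟨_, hx.1⟩)
  have hc : ContDiffAt ℝ p (f ∘ cp) x₀ := by
    obtain ⟨W, hW, hxW, F, hF, hFf⟩ := hf x₀ hx₀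
    have hFπ : ContDiffAt ℝ p (F ∘ π) x₀ :=
      ContDiffAt.comp x₀ (by rw [hπx]; exact hF.contDiffAt (hW.mem_nhds hxW)) hπ
    refine hFπ.congr_of_eventuallyEq ?_
    filter_upwards [hcpπ, hπT, hπ.continuousAt.eventually_mem
      (by rw [hπx]; exact hW.mem_nhds hxW)] with x h1 h2 h3
    rw [Function.comp_apply, Function.comp_apply, h1, hFf _ ⟨h2.1.1, h3⟩]
  refine ⟨hc, ?_, hcpπ.self_of_nhds.trans hπx, gradient g x₀, hg0, fun v hv => ?_, ?_⟩
  · filter_upwards [hcpπ, hπT] with x h1 h2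
    rwa [h1]
  · refine inner_gradient_eq_zero_of_mem_tangentConeAt (S := T)
      ((hg.contDiffAt (hU.mem_nhds hxU)).differentiableAt hp10) ?_ ?_ hv
    · filter_upwards [self_mem_nhdsWithin, nhdsWithin_le_nhds (hU.mem_nhds hxU)] with y h1 h2
      exact (hTU ▸ (⟨h1, h2⟩ : y ∈ T ∩ U) : y ∈ {y ∈ U | g y = 0}).2
    · exact (hTU ▸ (⟨hx₀, hxU⟩ : x₀ ∈ T ∩ U) : x₀ ∈ {y ∈ U | g y = 0}).2
  · have hl : HasDerivAt (fun t : ℝ => x₀ + t • gradient g x₀) (gradient g x₀) 0 := by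
      simpa using ((hasDerivAt_id (0 : ℝ)).smul_const (gradient g x₀)).const_add x₀
    have hl0 : x₀ + (0 : ℝ) • gradient g x₀ = x₀ := by simp
    have hd := (hc.differentiableAt hp0).hasFDerivAt
    have hcomp : HasDerivAt (fun t : ℝ => (f ∘ cp) (x₀ + t • gradient g x₀))
        (fderiv ℝ (f ∘ cp) x₀ (gradient g x₀)) 0 := by
      refine HasFDerivAt.comp_hasDerivAt (0 : ℝ) (l := f ∘ cp) ?_ hl
      rwa [hl0]
    have hconst : (fun t : ℝ => (f ∘ cp) (x₀ + t • gradient g x₀)) =ᶠ[𝓝 0] fun _ => f x₀ := by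
      have ht := hl.continuousAt.tendsto
      rw [hl0] at ht
      filter_upwards [hπn, ht.eventually hcpπ] with t h1 h2
      rw [Function.comp_apply, h2, h1]
    have h0 := (hcomp.congr_of_eventuallyEq hconst.symm).unique (hasDerivAt_const (0 : ℝ) (f x₀))
    rw [real_inner_comm, gradient, InnerProductSpace.toDual_symm_apply]
    exact h0

/-- Unit normals of `S` at `x` are multiples of any nonzero normal `n` of a set `T ⊇ S`. -/
theorem IsHypersurfaceWithBoundary.inner_unitNormal_eq_zero {k : ℕ} (hk : 1 ≤ k)
    {S T : Set (EuclideanSpace ℝ (Fin m))} (hS : IsHypersurfaceWithBoundary k S) (hST : S ⊆ T)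
    {x n ν w : EuclideanSpace ℝ (Fin m)} (hx : x ∈ S) (hν : IsUnitNormal S x ν) (hn : n ≠ 0)
    (hnT : ∀ v ∈ tangentConeAt ℝ T x, inner ℝ n v = 0) (hnw : inner ℝ n w = 0) :
    inner ℝ ν w = 0 := by
  obtain ⟨e, he⟩ := hS.exists_normal_direction hk hx
  obtain ⟨α, rfl⟩ := he ν hν.2
  obtain ⟨β, rfl⟩ := he n fun v hv => hnT v (tangentConeAt_mono hST hv)
  have hβ : β ≠ 0 := (smul_ne_zero_iff.1 hn).1
  rw [inner_smul_left] at hnw ⊢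
  rw [(mul_eq_zero.1 hnw).resolve_left (by simpa using hβ), mul_zero]

/-! ### Periodic continuation from a box -/

theorem isOpen_openBox (a b : Fin m → ℝ) : IsOpen (openBox a b) := by
  have : openBox a b = ⋂ i, {x : EuclideanSpace ℝ (Fin m) | a i < x i} ∩ {x | x i < b i} := by
    ext x
    simp [openBox]
  rw [this]
  exact isOpen_iInter_of_finite fun i =>
    (isOpen_lt (by fun_prop) (by fun_prop)).inter (isOpen_lt (by fun_prop) (by fun_prop))

theorem isBounded_openBox (a b : Fin m → ℝ) : Bornology.IsBounded (openBox a b) := by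
  have h : Bornology.IsBounded (WithLp.ofLp ⁻¹' Set.Icc a b : Set (EuclideanSpace ℝ (Fin m))) :=
    (PiLp.antilipschitzWith_ofLp 2 _).isBounded_preimage (Metric.isBounded_Icc a b)
  exact h.subset fun x hx => ⟨fun i => (hx i).1.le, fun i => (hx i).2.le⟩

/-- The representative of `x` modulo the lattice `∏ᵢ (bᵢ - aᵢ) ℤ` in the half-open box
`∏ᵢ [aᵢ, bᵢ)`. -/
noncomputable def boxMod (a b : Fin m → ℝ) (hab : ∀ i, a i < b i)
    (x : EuclideanSpace ℝ (Fin m)) : EuclideanSpace ℝ (Fin m) :=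
  WithLp.toLp 2 fun i => toIcoMod (sub_pos.2 (hab i)) (a i) (x i)

section boxMod

variable {a b : Fin m → ℝ} (hab : ∀ i, a i < b i)

theorem boxMod_apply (x : EuclideanSpace ℝ (Fin m)) (i : Fin m) :
    boxMod a b hab x i = toIcoMod (sub_pos.2 (hab i)) (a i) (x i) := rfl

theorem boxMod_add_single (i : Fin m) (x : EuclideanSpace ℝ (Fin m)) :
    boxMod a b hab (x + EuclideanSpace.single i (b i - a i)) = boxMod a b hab x := by
  ext j
  rw [boxMod_apply, boxMod_apply]
  rcases eq_or_ne j i with rfl | hj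
  · simp [toIcoMod_add_right]
  · simp [hj]

/-- If the translation taking `x` to `boxMod x` takes `y` into the open box, then it takes `y` to
`boxMod y`. -/
theorem boxMod_eq_of_mem {x y : EuclideanSpace ℝ (Fin m)}
    (h : y + (boxMod a b hab x - x) ∈ openBox a b) :
    boxMod a b hab y = y + (boxMod a b hab x - x) := by
  ext i
  rw [boxMod_apply, toIcoMod_eq_iff]
  refine ⟨⟨(h i).1.le, by simpa using (h i).2⟩, toIcoDiv (sub_pos.2 (hab i)) (a i) (x i), ?_⟩
  have := self_sub_toIcoMod (sub_pos.2 (hab i)) (a i) (x i)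
  rw [← this]
  simp [boxMod_apply]

theorem boxMod_eq_self {x : EuclideanSpace ℝ (Fin m)} (h : x ∈ openBox a b) :
    boxMod a b hab x = x := by
  ext i
  rw [boxMod_apply, toIcoMod_eq_self]
  exact ⟨(h i).1.le, by simpa using (h i).2⟩

theorem toIcoMod_eq_add_or_of_abs_lt {α L t x : ℝ} (hL : 0 < L) (hx : toIcoMod hL α x = α)
    (ht : |t| < L) : toIcoMod hL α (x + t) = α + t ∨ toIcoMod hL α (x + t) = α + L + t := by
  obtain ⟨h1, h2⟩ := abs_lt.1 ht
  have hz := self_sub_toIcoMod hL α x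
  rw [hx] at hz
  rcases le_or_gt 0 t with h | h
  · refine Or.inl ((toIcoMod_eq_iff hL).2 ⟨⟨by linarith, by linarith⟩, toIcoDiv hL α x, ?_⟩)
    rw [← hz]; ring
  · refine Or.inr ((toIcoMod_eq_iff hL).2 ⟨⟨by linarith, by linarith⟩, toIcoDiv hL α x - 1, ?_⟩)
    rw [sub_smul, ← hz, one_smul]; ring

/-- Near points congruent to a boundary point of the box, `boxMod` avoids each compact subset of the
box: some coordinate of `boxMod y` is close to an endpoint of its interval. -/
theorem eventually_boxMod_notMem {K : Set (EuclideanSpace ℝ (Fin m))} (hK : IsCompact K)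
    (hKΩ : K ⊆ openBox a b) {x : EuclideanSpace ℝ (Fin m)} (hx : boxMod a b hab x ∉ openBox a b) :
    ∀ᶠ y in 𝓝 x, boxMod a b hab y ∉ K := by
  obtain ⟨i, hi⟩ : ∃ i, boxMod a b hab x i = a i := by
    by_contra! hcon
    refine hx fun i => ?_
    have h := toIcoMod_mem_Ico (sub_pos.2 (hab i)) (a i) (x i)
    rw [add_sub_cancel] at h
    exact ⟨lt_of_le_of_ne h.1 (hcon i).symm, h.2⟩
  have hL := sub_pos.2 (hab i)
  have hC : IsClosed ((fun z : EuclideanSpace ℝ (Fin m) => z i) '' K) :=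
    (hK.image (by fun_prop)).isClosed
  have ha : a i ∉ (fun z : EuclideanSpace ℝ (Fin m) => z i) '' K := by
    rintro ⟨z, hz, h⟩
    exact (hKΩ hz i).1.ne' h
  have hb : b i ∉ (fun z : EuclideanSpace ℝ (Fin m) => z i) '' K := by
    rintro ⟨z, hz, h⟩
    exact (hKΩ hz i).2.ne h
  have hy : Tendsto (fun y : EuclideanSpace ℝ (Fin m) => y i - x i) (𝓝 x) (𝓝 0) := by
    have : Continuous fun y : EuclideanSpace ℝ (Fin m) => y i - x i := by fun_prop
    simpa using this.tendsto x
  have hya := (hy.const_add (a i)).eventually_mem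
    (by simpa using hC.isOpen_compl.mem_nhds ha)
  have hyb := (hy.const_add (b i)).eventually_mem
    (by simpa using hC.isOpen_compl.mem_nhds hb)
  have hyL := hy.abs.eventually (gt_mem_nhds (by simpa using hL : |(0 : ℝ)| < b i - a i))
  filter_upwards [hya, hyb, hyL] with y h1 h2 h3 hyK
  have h4 := toIcoMod_eq_add_or_of_abs_lt hL hi h3
  rw [add_sub_cancel, add_sub_cancel, ← boxMod_apply hab] at h4
  rcases h4 with h | h
  · exact h1 ⟨_, hyK, h⟩
  · exact h2 ⟨_, hyK, h⟩

theorem ContDiff.comp_boxMod {n : WithTop ℕ∞} {F : EuclideanSpace ℝ (Fin m) → ℝ}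
    (hF : ContDiff ℝ n F) {K : Set (EuclideanSpace ℝ (Fin m))} (hK : IsCompact K)
    (hKΩ : K ⊆ openBox a b) (hFK : ∀ x ∉ K, F x = 0) :
    ContDiff ℝ n fun x => F (boxMod a b hab x) := by
  rw [contDiff_iff_contDiffAt]
  intro x
  have hτ : Continuous fun y => y + (boxMod a b hab x - x) := by fun_prop
  have hτx : x + (boxMod a b hab x - x) = boxMod a b hab x := by abel
  by_cases hx : boxMod a b hab x ∈ openBox a b
  · have hev : (fun y => F (boxMod a b hab y)) =ᶠ[𝓝 x]
        fun y => F (y + (boxMod a b hab x - x)) := by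
      filter_upwards [hτ.continuousAt.eventually_mem
        (by rw [hτx]; exact (isOpen_openBox a b).mem_nhds hx)] with y hy
      rw [boxMod_eq_of_mem hab hy]
    exact (hF.comp (contDiff_id.add contDiff_const)).contDiffAt.congr_of_eventuallyEq hev
  · have hev : (fun y => F (boxMod a b hab y)) =ᶠ[𝓝 x] fun _ => 0 :=
      (eventually_boxMod_notMem hab hK hKΩ hx).mono fun y hy => hFK _ hy
    exact contDiffAt_const.congr_of_eventuallyEq hev

end boxMod

/-! ### Cutoff and construction of the extension -/

/-- A `Cᵖ` function on an open set `W` can be modified away from a neighbourhood of a compact `C ⊆ W`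
so as to become a `Cᵖ` function on the whole space with compact support in `W`. -/
theorem ContDiffOn.exists_contDiff_eqOn_nhdsSet_of_isCompact {E : Type*} [NormedAddCommGroup E]
    [NormedSpace ℝ E] [FiniteDimensional ℝ E] {p : ℕ} {C W : Set E} {G : E → ℝ}
    (hC : IsCompact C) (hW : IsOpen W) (hCW : C ⊆ W) (hG : ContDiffOn ℝ p G W) :
    ∃ (F : E → ℝ) (K : Set E), ContDiff ℝ p F ∧ IsCompact K ∧ K ⊆ W ∧ (∀ x ∉ K, F x = 0) ∧
      ∀ᶠ x in 𝓝ˢ C, F x = G x := by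
  obtain ⟨K, hK, hCK, hKW⟩ := exists_compact_between hC hW hCW
  obtain ⟨χ, hχ1, hχ0, -⟩ := exists_contMDiffMap_one_nhds_of_subset_interior
    (modelWithCornersSelf ℝ E) (n := p) hC.isClosed hCK
  have hχ : ContDiff ℝ p χ := χ.contMDiff.contDiff
  refine ⟨fun x => χ x * G x, K, ?_, hK, hKW, fun x hx => by simp [hχ0 x hx], ?_⟩
  · rw [contDiff_iff_contDiffAt]
    intro x
    by_cases hx : x ∈ W
    · exact hχ.contDiffAt.mul (hG.contDiffAt (hW.mem_nhds hx))
    · have hev : (fun x => χ x * G x) =ᶠ[𝓝 x] fun _ => 0 := by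
        filter_upwards [hK.isClosed.isOpen_compl.mem_nhds fun h => hx (hKW h)] with y hy
        rw [hχ0 y hy, zero_mul]
      exact contDiffAt_const.congr_of_eventuallyEq hev
  · filter_upwards [hχ1] with x hx
    rw [hx, one_mul]

theorem proposition2p3 (m p : ℕ) (hp : 1 ≤ p) (a b : Fin m → ℝ) (hab : ∀ i, a i < b i)
    (S T : Set (EuclideanSpace ℝ (Fin m)))
    (hS : IsHypersurfaceWithBoundary (p + 1) S) (hSΩ : S ⊆ openBox a b)
    (hT : IsHypersurface (p + 1) T) (hTΩ : T ⊆ openBox a b)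
    (hST : closure S ⊆ T)
    (f : EuclideanSpace ℝ (Fin m) → ℝ) (hf : IsContDiffOnSurface p f T) :
    ∃ F : EuclideanSpace ℝ (Fin m) → ℝ,
      ContDiff ℝ p F ∧ IsBoxPeriodic a b F ∧
      IsFirstOrderCPLikeExtension (openBox a b) S f F ∧
      (∃ V : Set (EuclideanSpace ℝ (Fin m)), IsOpen V ∧ closure S ⊆ V ∧ V ⊆ openBox a b ∧
        ∀ x ∈ V, ∃ y, IsClosestPoint T x y ∧ (∀ z, IsClosestPoint T x z → z = y) ∧ F x = f y) ∧
      ∃ K : Set (EuclideanSpace ℝ (Fin m)), IsCompact K ∧ K ⊆ openBox a b ∧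
        ∀ x ∈ openBox a b, x ∉ K → F x = 0 := by
  have hcp : ∀ x, ∃ y, (∃ z, IsClosestPoint T x z) → IsClosestPoint T x y := fun x => by
    by_cases h : ∃ z, IsClosestPoint T x z
    · exact ⟨h.choose, fun _ => h.choose_spec⟩
    · exact ⟨x, fun h' => absurd h' h⟩
  choose cp hcp using hcp
  have hloc := fun x (hx : x ∈ T) => hT.closestPoint_extension_at hp hf hcp hx
  have hC : IsCompact (closure S) := ((isBounded_openBox a b).subset hSΩ).isCompact_closure
  -- the points around which `f ∘ cp` is a `Cᵖ` function given by unique closest points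
  let W : Set (EuclideanSpace ℝ (Fin m)) := interior {x | x ∈ openBox a b ∧
    ContDiffAt ℝ p (f ∘ cp) x ∧ IsClosestPoint T x (cp x) ∧ ∀ z, IsClosestPoint T x z → z = cp x}
  have hWspec : ∀ x ∈ W, _ := fun x hx => interior_subset hx
  have hTW : T ⊆ W := fun x hx => mem_interior_iff_mem_nhds.2 <| by
    filter_upwards [(isOpen_openBox a b).mem_nhds (hTΩ hx),
      (hloc x hx).1.eventually (by simp), (hloc x hx).2.1] with y h1 h2 h3
    exact ⟨h1, h2, h3⟩
  obtain ⟨F₀, K, hF₀, hK, hKW, hF₀K, hF₀G⟩ :=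
    ContDiffOn.exists_contDiff_eqOn_nhdsSet_of_isCompact (p := p) (G := f ∘ cp) hC
      isOpen_interior (hST.trans hTW) fun x hx => (hWspec x hx).2.1.contDiffWithinAt
  have hKΩ : K ⊆ openBox a b := fun x hx => (hWspec x (hKW hx)).1
  let F : EuclideanSpace ℝ (Fin m) → ℝ := fun x => F₀ (boxMod a b hab x)
  have hF : ContDiff ℝ p F := hF₀.comp_boxMod hab hK hKΩ hF₀K
  have hFF₀ : ∀ x ∈ openBox a b, F x = F₀ x := fun x hx => by
    simp only [F, boxMod_eq_self hab hx]
  let A : Set (EuclideanSpace ℝ (Fin m)) := {x | F₀ x = (f ∘ cp) x}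
  let V := interior A ∩ W
  have hV : IsOpen V := isOpen_interior.inter isOpen_interior
  have hSV : closure S ⊆ V :=
    subset_inter (subset_interior_iff_mem_nhdsSet.2 hF₀G) (hST.trans hTW)
  have hVF : ∀ x ∈ V, F x = (f ∘ cp) x := fun x hx =>
    (hFF₀ x (hWspec x hx.2).1).trans (show x ∈ A from interior_subset hx.1)
  refine ⟨F, hF, fun i x => by simp only [F, boxMod_add_single], ⟨?_, ?_, ?_⟩, ?_, ?_⟩
  · exact (hF.of_le (by exact_mod_cast hp)).contDiffOn
  · intro x hx ν hν
    obtain ⟨n, hn0, hnT, hnG⟩ := (hloc x (hST (subset_closure hx))).2.2.2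
    have hFG : F =ᶠ[𝓝 x] f ∘ cp :=
      eventually_of_mem (hV.mem_nhds (hSV (subset_closure hx))) hVF
    have hgrad : gradient F x = gradient (f ∘ cp) x := by
      rw [gradient, gradient, hFG.fderiv_eq]
    rw [hgrad]
    exact hS.inner_unitNormal_eq_zero (by omega) (subset_closure.trans hST) hx hν hn0 hnT hnG
  · intro x hx
    rw [hVF x (hSV (subset_closure hx)), Function.comp_apply,
      (hloc x (hST (subset_closure hx))).2.2.1]
  · exact ⟨V, hV, hSV, fun x hx => (hWspec x hx.2).1, fun x hx =>
      ⟨cp x, (hWspec x hx.2).2.2.1, (hWspec x hx.2).2.2.2, hVF x hx⟩⟩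
  · exact ⟨K, hK, hKΩ, fun x hx hxK => (hFF₀ x hx).trans (hF₀K x hxK)⟩
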